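/- Let $m\ge 2$ be an integer and let $C''\subset\mathbb{P}^2=\mathbb{P}^2(\mathbb{C})$ be the plane curve $$C'':\quad yz\,(x^my^m+y^mz^m+x^mz^m)(y^m+z^m)=0 .$$ For a reduced plane curve $C$, write $M(C)=\mathbb{P}^2\setminus C$ for its complement (with the classical topology). A point $p\in C$ is called a \emph{modular point} of $C$ if the central projection $\pi_p:\mathbb{P}^2\setminus\{p\}\to\mathbb{P}^1$ from $p$ restricts to a locally trivial fibration of $M(C)$ over its image $\pi_p(M(C))\subset\mathbb{P}^1$, and $C$ is called \emph{supersolvable} if it has at least one modular point. Then $C''$ is a reduced curve and the point $(1:0:0)\in C''$ is a modular point of $C''$; in particular, $C''$ is supersolvable. Moreover, the complement $M(C'')$ is a $K(\pi,1)$ space, that is, $M(C'')$ is path connected and $\pi_n(M(C''))=0$ for all $n\ge 2$. -/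

import Mathlib

open scoped LinearAlgebra.Projectivization Topology
open MvPolynomial (X)

namespace PlaneCurve

/-- The quotient topology on the projectivization of a topological vector space. -/
instance projectivizationTopology (K V : Type*) [DivisionRing K] [AddCommGroup V] [Module K V]
    [TopologicalSpace V] : TopologicalSpace (ℙ K V) :=
  TopologicalSpace.coinduced (Projectivization.mk' K) inferInstance

/-- The complex projective plane, with its classical topology. -/
abbrev P2 : Type := ℙ ℂ (Fin 3 → ℂ)

/-- `F = 0` is (the equation of) a reduced plane curve: `F` is homogeneous of positive degree and
has no multiple factors. -/
def IsReducedCurve (F : MvPolynomial (Fin 3) ℂ) : Prop :=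
  (∃ d : ℕ, 1 ≤ d ∧ F.IsHomogeneous d) ∧ Squarefree F

/-- The points of the curve `F = 0` in the projective plane. For homogeneous `F` the condition
does not depend on the chosen homogeneous coordinates `q.rep` of `q`. -/
def points (F : MvPolynomial (Fin 3) ℂ) : Set P2 :=
  {q | MvPolynomial.eval q.rep F = 0}

/-- The complement `M(C)` of the curve `C : F = 0` in the projective plane. -/
abbrev complement (F : MvPolynomial (Fin 3) ℂ) : Set P2 := (points F)ᶜ

/-- The projective line of all lines through the point `p` of the projective plane. -/
abbrev Pencil (p : P2) : Type := ℙ ℂ ((Fin 3 → ℂ) ⧸ p.submodule)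

theorem mkQ_rep_ne_zero {p q : P2} (h : q ≠ p) : p.submodule.mkQ q.rep ≠ 0 := by
  intro h0
  have h1 : q.rep ∈ p.submodule := by simpa using h0
  rw [Projectivization.submodule_eq, Submodule.mem_span_singleton] at h1
  obtain ⟨a, ha⟩ := h1
  apply h
  rw [← Projectivization.mk_rep q, ← Projectivization.mk_rep p,
    Projectivization.mk_eq_mk_iff']
  exact ⟨a, ha⟩

/-- The central projection `π_p : ℙ² \ {p} → ℙ¹`, sending a point `q` to the line joining `p`
and `q`. -/
noncomputable def centralProjection (p : P2) (q : {q : P2 // q ≠ p}) : Pencil p :=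
  Projectivization.mk ℂ (p.submodule.mkQ q.1.rep) (mkQ_rep_ne_zero q.2)

/-- The restriction of the central projection `π_p` to the complement of a curve through `p`. -/
noncomputable def complementProjection (F : MvPolynomial (Fin 3) ℂ) (p : P2) (hp : p ∈ points F)
    (q : complement F) : Pencil p :=
  centralProjection p ⟨q.1, fun h => q.2 (h ▸ hp)⟩

/-- `f : E → B` is a locally trivial fibration: there is a space `Y` such that every point of `B`
has an open neighbourhood `U` for which `f ⁻¹' U` is homeomorphic to `U × Y` over `U`. -/
def IsLocallyTrivialFibration {E B : Type} [TopologicalSpace E] [TopologicalSpace B]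
    (f : E → B) : Prop :=
  ∃ (Y : Type) (_ : TopologicalSpace Y), ∀ b : B, ∃ e : Bundle.Trivialization Y f, b ∈ e.baseSet

/-- The point `p` of the curve `C : F = 0` is modular: the central projection from `p` induces a
locally trivial fibration of the complement `M(C)` over its image in `ℙ¹`. -/
def IsModularPoint (F : MvPolynomial (Fin 3) ℂ) (p : P2) : Prop :=
  ∃ hp : p ∈ points F,
    IsLocallyTrivialFibration (Set.rangeFactorization (complementProjection F p hp))

/-- A reduced plane curve is supersolvable if it has at least one modular point. -/
def IsSupersolvable (F : MvPolynomial (Fin 3) ℂ) : Prop :=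
  IsReducedCurve F ∧ ∃ p : P2, IsModularPoint F p

/-- `M` is a `K(π, 1)` space (with `π` its fundamental group): it is path connected and all its
homotopy groups in degrees at least two are trivial. -/
def IsKPiOne (M : Type) [TopologicalSpace M] : Prop :=
  PathConnectedSpace M ∧ ∀ n : ℕ, 2 ≤ n → ∀ x : M, Subsingleton (π_ n M x)

/-- The polynomial `yz(xᵐyᵐ + yᵐzᵐ + xᵐzᵐ)(yᵐ + zᵐ)`, where `x, y, z` are the variables with
indices `0, 1, 2`. -/
noncomputable def curve (m : ℕ) : MvPolynomial (Fin 3) ℂ :=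
  X 1 * X 2 * (X 0 ^ m * X 1 ^ m + X 1 ^ m * X 2 ^ m + X 0 ^ m * X 2 ^ m) * (X 1 ^ m + X 2 ^ m)

/-- The point `(1 : 0 : 0)`. -/
noncomputable def p₁ : P2 := Projectivization.mk ℂ ![1, 0, 0] (by simp)

end PlaneCurve

/-! In the coordinates w = x/y and s = y/z the complement is {s ≠ 0, 1 + s^m ≠ 0, w^m (1 + s^m) + 1
≠ 0}, and projection from (1:0:0) becomes (w, s) ↦ s. A local m-th root u of 1 + s^m turns the
fibre, via t = w u, into the fixed set {t^m + 1 ≠ 0}; this is modularity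
(`isLocallyTrivialFibration_affineProjection`).

Asphericity avoids universal covers and exact sequences. `exists_factorization_of_isOpen` shows that
a map from a cube of dimension at least two to a planar open set, constant on the boundary, factors
through the plane with the boundary sent to 0. Its proof is Koebe's uniformization argument:
square-root maps of the disk, iterated finitely often, give a map P which lifts cubes and sends a
prescribed smaller disk into U, while Schwarz–Pick confines the lifts to such a disk independently
of P.

Factoring the s-component first makes u exist globally, since the plane is simply connected;
factoring t = w u next makes the whole map factor through the contractible ℂ × ℂ
(`homotopic_const_affineModel`).

For reducedness, a repeated prime factor would divide partial derivatives, and then two different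
variables. -/

/-- The Möbius transformation of the unit disk sending `a` to `0`. -/
noncomputable def diskMobius (a z : ℂ) : ℂ := (z - a) / (1 - (starRingEnd ℂ) a * z)

/-! ### Automorphisms of the unit disk. -/

section Mobius
open Metric Set ComplexConjugate

variable {a z : ℂ}

theorem one_sub_conj_mul_ne_zero (ha : ‖a‖ < 1) (hz : ‖z‖ < 1) : 1 - conj a * z ≠ 0 := by
  intro h
  have h1 : ‖conj a * z‖ = 1 := by rw [← sub_eq_zero.mp h]; simp
  rw [norm_mul, RCLike.norm_conj] at h1
  nlinarith [norm_nonneg a, norm_nonneg z]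

theorem one_sub_normSq_diskMobius (ha : ‖a‖ < 1) (hz : ‖z‖ < 1) :
    1 - ‖diskMobius a z‖ ^ 2 =
      (1 - ‖a‖ ^ 2) * (1 - ‖z‖ ^ 2) / ‖1 - conj a * z‖ ^ 2 := by
  have h := one_sub_conj_mul_ne_zero ha hz
  have h' : ‖1 - conj a * z‖ ^ 2 ≠ 0 := by positivity
  rw [diskMobius, norm_div, div_pow, eq_div_iff h', sub_mul, div_mul_cancel₀ _ h', one_mul]
  simp only [← Complex.normSq_eq_norm_sq, Complex.normSq_apply]
  simp
  ring

theorem norm_diskMobius_lt_one (ha : ‖a‖ < 1) (hz : ‖z‖ < 1) : ‖diskMobius a z‖ < 1 := by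
  have h := one_sub_conj_mul_ne_zero ha hz
  have h1 : 0 < 1 - ‖diskMobius a z‖ ^ 2 := by
    rw [one_sub_normSq_diskMobius ha hz]
    have := norm_nonneg a
    have := norm_nonneg z
    have : 0 < 1 - ‖a‖ ^ 2 := by nlinarith
    have : 0 < 1 - ‖z‖ ^ 2 := by nlinarith
    positivity
  nlinarith [norm_nonneg (diskMobius a z)]

theorem diskMobius_neg_diskMobius (ha : ‖a‖ < 1) (hz : ‖z‖ < 1) :
    diskMobius (-a) (diskMobius a z) = z := by
  have h := one_sub_conj_mul_ne_zero ha hz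
  have h2 := one_sub_conj_mul_ne_zero ha ha
  simp only [diskMobius, map_neg, sub_neg_eq_add, neg_mul]
  generalize conj a = c at h h2 ⊢
  have h3 : 1 + c * ((z - a) / (1 - c * z)) = (1 - c * a) / (1 - c * z) := by
    rw [eq_div_iff h, add_mul, mul_assoc, div_mul_cancel₀ _ h]
    ring
  have h4 : (z - a) / (1 - c * z) + a = z * (1 - c * a) / (1 - c * z) := by
    rw [eq_div_iff h, add_mul, div_mul_cancel₀ _ h]
    ring
  rw [h3, h4, div_div_div_cancel_right₀ h, mul_div_cancel_right₀ _ h2]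

theorem diskMobius_diskMobius_neg (ha : ‖a‖ < 1) (hz : ‖z‖ < 1) :
    diskMobius a (diskMobius (-a) z) = z := by
  simpa using diskMobius_neg_diskMobius (a := -a) (by simpa using ha) hz

theorem diskMobius_eq_zero_iff (ha : ‖a‖ < 1) (hz : ‖z‖ < 1) : diskMobius a z = 0 ↔ z = a := by
  rw [diskMobius, div_eq_zero_iff, or_iff_left (one_sub_conj_mul_ne_zero ha hz), sub_eq_zero]

@[simp] theorem diskMobius_zero (a : ℂ) : diskMobius a 0 = -a := by simp [diskMobius]

theorem hasDerivAt_diskMobius (ha : ‖a‖ < 1) (hz : ‖z‖ < 1) :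
    HasDerivAt (diskMobius a) ((1 - (‖a‖ : ℂ) ^ 2) / (1 - conj a * z) ^ 2) z := by
  have h := one_sub_conj_mul_ne_zero ha hz
  have h1 : HasDerivAt (fun z : ℂ => z - a) 1 z := (hasDerivAt_id z).sub_const a
  have h2 : HasDerivAt (fun z : ℂ => 1 - conj a * z) (-(conj a * 1)) z :=
    ((hasDerivAt_id z).const_mul (conj a)).const_sub 1
  refine (h1.div h2 h).congr_deriv ?_
  rw [← Complex.conj_mul']
  congr 1
  ring

theorem one_sub_norm_sq_ne_zero (ha : ‖a‖ < 1) : 1 - (‖a‖ : ℂ) ^ 2 ≠ 0 := by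
  have h : (1 - ‖a‖ ^ 2 : ℝ) ≠ 0 := by nlinarith [norm_nonneg a]
  exact_mod_cast h

theorem differentiableOn_diskMobius (ha : ‖a‖ < 1) :
    DifferentiableOn ℂ (diskMobius a) (ball 0 1) := fun _ hz =>
  (hasDerivAt_diskMobius ha (mem_ball_zero_iff.mp hz)).differentiableAt.differentiableWithinAt

theorem mapsTo_diskMobius (ha : ‖a‖ < 1) : MapsTo (diskMobius a) (ball 0 1) (ball 0 1) :=
  fun _ hz => mem_ball_zero_iff.mpr (norm_diskMobius_lt_one ha (mem_ball_zero_iff.mp hz))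

/-! ### Koebe's square-root map. -/

/-- The two-fold branched self-covering of the unit disk fixing `0`, with critical
value `-b ^ 2`. -/
noncomputable def koebeMap (b w : ℂ) : ℂ := diskMobius (b ^ 2) (diskMobius (-b) w ^ 2)

variable {b w : ℂ}

theorem norm_sq_lt_one (hb : ‖b‖ < 1) : ‖b ^ 2‖ < 1 := by
  rw [norm_pow]; nlinarith [norm_nonneg b]

theorem koebeMap_zero (hb : ‖b‖ < 1) : koebeMap b 0 = 0 := by
  rw [koebeMap, diskMobius_zero, neg_neg,
    diskMobius_eq_zero_iff (norm_sq_lt_one hb) (norm_sq_lt_one hb)]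

theorem norm_koebeMap_lt_one (hb : ‖b‖ < 1) (hw : ‖w‖ < 1) : ‖koebeMap b w‖ < 1 :=
  norm_diskMobius_lt_one (norm_sq_lt_one hb)
    (norm_sq_lt_one (norm_diskMobius_lt_one (by simpa using hb) hw))

theorem diskMobius_koebeMap (hb : ‖b‖ < 1) (hw : ‖w‖ < 1) :
    diskMobius (-b ^ 2) (koebeMap b w) = diskMobius (-b) w ^ 2 :=
  diskMobius_neg_diskMobius (norm_sq_lt_one hb)
    (norm_sq_lt_one (norm_diskMobius_lt_one (by simpa using hb) hw))

theorem hasDerivAt_koebeMap (hb : ‖b‖ < 1) (hw : ‖w‖ < 1) :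
    HasDerivAt (koebeMap b)
      ((1 - (‖b ^ 2‖ : ℂ) ^ 2) / (1 - conj (b ^ 2) * diskMobius (-b) w ^ 2) ^ 2 *
        (2 * diskMobius (-b) w * ((1 - (‖-b‖ : ℂ) ^ 2) / (1 - conj (-b) * w) ^ 2))) w := by
  have hb' : ‖-b‖ < 1 := by simpa using hb
  have h1 := hasDerivAt_diskMobius hb' hw
  have h2 := hasDerivAt_diskMobius (norm_sq_lt_one hb)
    (norm_sq_lt_one (norm_diskMobius_lt_one hb' hw))
  exact HasDerivAt.comp w h2 ((h1.pow 2).congr_deriv (by simp))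

theorem deriv_koebeMap_ne_zero (hb : ‖b‖ < 1) (hw : ‖w‖ < 1) (h : koebeMap b w ≠ -b ^ 2) :
    deriv (koebeMap b) w ≠ 0 := by
  have hb' : ‖-b‖ < 1 := by simpa using hb
  have hn := norm_diskMobius_lt_one hb' hw
  have h0 : diskMobius (-b) w ≠ 0 := by
    intro h0
    apply h
    rw [koebeMap, h0]; simp
  rw [(hasDerivAt_koebeMap hb hw).deriv]
  have h1 := one_sub_norm_sq_ne_zero (norm_sq_lt_one hb)
  have h2 := one_sub_norm_sq_ne_zero hb'
  have h3 := one_sub_conj_mul_ne_zero hb' hw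
  have h4 := one_sub_conj_mul_ne_zero (norm_sq_lt_one hb) (norm_sq_lt_one hn)
  exact mul_ne_zero (div_ne_zero h1 (pow_ne_zero _ h4))
    (mul_ne_zero (mul_ne_zero two_ne_zero h0) (div_ne_zero h2 (pow_ne_zero _ h3)))

theorem norm_deriv_koebeMap_zero (hb : ‖b‖ < 1) :
    ‖deriv (koebeMap b) 0‖ = 2 * ‖b‖ / (1 + ‖b‖ ^ 2) := by
  have h0 : 1 - ‖b‖ ^ 2 ≠ 0 := by nlinarith [norm_nonneg b]
  have h1 : 1 + ‖b‖ ^ 2 ≠ 0 := by positivity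
  have h2 : (deriv (koebeMap b) 0) =
      ((1 - (‖b‖ ^ 2) ^ 2)⁻¹ * (1 - ‖b‖ ^ 2) : ℝ) * (2 * b) := by
    rw [(hasDerivAt_koebeMap hb (by simp)).deriv]
    have h3 : (1 - (‖b‖ ^ 2 : ℂ) ^ 2) ≠ 0 := by
      have : (1 - (‖b‖ ^ 2) ^ 2 : ℝ) ≠ 0 := by
        rw [show (1 - (‖b‖ ^ 2) ^ 2 : ℝ) = (1 - ‖b‖ ^ 2) * (1 + ‖b‖ ^ 2) by ring]
        exact mul_ne_zero h0 h1
      exact_mod_cast this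
    simp only [diskMobius_zero, neg_neg, Complex.conj_mul']
    simp only [norm_pow, norm_neg, mul_zero, sub_zero]
    push_cast
    field_simp
  rw [h2, norm_mul, Complex.norm_real, Real.norm_eq_abs, norm_mul,
    show (1 - (‖b‖ ^ 2) ^ 2 : ℝ) = (1 - ‖b‖ ^ 2) * (1 + ‖b‖ ^ 2) by ring, mul_inv,
    mul_right_comm, inv_mul_cancel₀ h0, one_mul, abs_of_pos (by positivity)]
  simp
  ring

/-! ### Lifting through iterated Koebe maps. -/

/-- Every nowhere vanishing continuous complex function on `T` has a continuous square root. -/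
def HasContinuousSqrt (T : Type) [TopologicalSpace T] : Prop :=
  ∀ h : T → ℂ, Continuous h → (∀ t, h t ≠ 0) → ∃ g : T → ℂ, Continuous g ∧ ∀ t, g t ^ 2 = h t

theorem exists_continuous_root {T : Type} [TopologicalSpace T] [SimplyConnectedSpace T]
    [LocallyPathConnectedSpace T] {n : ℕ} (hn : n ≠ 0) {h : T → ℂ} (hc : Continuous h)
    (h0 : ∀ t, h t ≠ 0) : ∃ g : T → ℂ, Continuous g ∧ ∀ t, g t ^ n = h t := by
  have : NeZero n := ⟨hn⟩
  have : Nonempty T := PathConnectedSpace.nonempty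
  obtain ⟨t₀⟩ := this
  obtain ⟨e, he⟩ := IsAlgClosed.exists_pow_nat_eq (h t₀) (Nat.pos_of_ne_zero hn)
  have cov : IsCoveringMapOn (fun x : ℂ ↦ x ^ n) {0}ᶜ :=
    isCoveringMapOn_npow n (by exact_mod_cast hn)
  obtain ⟨F, ⟨-, hF⟩, -⟩ := cov.existsUnique_continuousMap_lifts ⟨h, hc⟩ (a₀ := t₀) he
    (fun a => h0 a)
  exact ⟨F, F.continuous, fun t => congrFun hF t⟩

theorem hasContinuousSqrt_ball (c : ℂ) {r : ℝ} (hr : 0 < r) : HasContinuousSqrt (ball c r) := by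
  intro h hc h0
  have : ContractibleSpace (ball c r) :=
    (convex_ball c r).contractibleSpace ⟨c, mem_ball_self hr⟩
  have : LocallyPathConnectedSpace (ball c r) := isOpen_ball.locallyPathConnectedSpace
  exact exists_continuous_root two_ne_zero hc h0

/-- Retracting ℝ^N onto the cube coordinatewise moves the problem to a simply connected, locally
path connected space. -/
theorem hasContinuousSqrt_cube (N : Type) [Fintype N] : HasContinuousSqrt (N → unitInterval) := by
  intro h hc h0
  obtain ⟨g, hg, hg'⟩ := exists_continuous_root (T := N → ℝ) two_ne_zero
    (h := fun t => h (fun i => projIcc 0 1 zero_le_one (t i)))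
    (hc.comp (continuous_pi fun i => continuous_projIcc.comp (continuous_apply i))) (fun t => h0 _)
  refine ⟨fun t => g (fun i => t i), hg.comp (by fun_prop), fun t => ?_⟩
  simp [hg']

/-- `P` is a holomorphic self-map of the unit disk fixing `0`, which behaves like a covering
over `U`. -/
structure IsDiskLift (U : Set ℂ) (P : ℂ → ℂ) : Prop where
  differentiableOn : DifferentiableOn ℂ P (ball 0 1)
  mapsTo : MapsTo P (ball 0 1) (ball 0 1)
  map_zero : P 0 = 0
  deriv_ne_zero : ∀ v ∈ ball (0 : ℂ) 1, P v ∈ U → deriv P v ≠ 0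
  exists_lift : ∀ (T : Type) [TopologicalSpace T], HasContinuousSqrt T → ∀ h : T → ℂ,
    Continuous h → (∀ t, h t ∈ U) → ∀ t₀, ∀ v ∈ ball (0 : ℂ) 1, P v = h t₀ →
    ∃ k : T → ℂ, Continuous k ∧ (∀ t, k t ∈ ball (0 : ℂ) 1) ∧ (∀ t, P (k t) = h t) ∧ k t₀ = v
  -- Uniqueness is relative to a subset because it is applied to intervals in ℝ and to the boundary
  -- of a cube.
  unique : ∀ (T : Type) [TopologicalSpace T] (S : Set T), IsPreconnected S → ∀ k₁ k₂ : T → ℂ,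
    ContinuousOn k₁ S → ContinuousOn k₂ S → MapsTo k₁ S (ball 0 1) → MapsTo k₂ S (ball 0 1) →
    (∀ t ∈ S, P (k₁ t) = P (k₂ t)) → (∀ t ∈ S, P (k₁ t) ∈ U) → ∀ t₀ ∈ S, k₁ t₀ = k₂ t₀ →
    EqOn k₁ k₂ S

theorem isDiskLift_id {U : Set ℂ} (hU : U ⊆ ball 0 1) : IsDiskLift U (fun z => z) where
  differentiableOn := differentiableOn_id
  mapsTo := fun _ h => h
  map_zero := rfl
  deriv_ne_zero := by simp
  exists_lift := fun T _ _ h hc hh t₀ v _ hv => ⟨h, hc, fun t => hU (hh t), fun _ => rfl, hv.symm⟩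
  unique := fun T _ S _ k₁ k₂ _ _ _ _ h _ _ _ _ => h

/-- The only critical value of the Koebe map is `-b ^ 2`, and `P` sends it outside `U`. Over `U` the
new map is therefore unbranched, and lifting through it amounts to taking a square root of a nowhere
vanishing function. -/
theorem IsDiskLift.comp_koebeMap {U : Set ℂ} {P : ℂ → ℂ} (hP : IsDiskLift U P) (hb : ‖b‖ < 1)
    (hPb : P (-b ^ 2) ∉ U) : IsDiskLift U (fun w => P (koebeMap b w)) := by
  have hb' : ‖-b‖ < 1 := by simpa using hb
  have hk : MapsTo (koebeMap b) (ball 0 1) (ball 0 1) := fun w hw =>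
    mem_ball_zero_iff.mpr (norm_koebeMap_lt_one hb (mem_ball_zero_iff.mp hw))
  have hd : DifferentiableOn ℂ (koebeMap b) (ball 0 1) := fun w hw =>
    (hasDerivAt_koebeMap hb (mem_ball_zero_iff.mp hw)).differentiableAt.differentiableWithinAt
  have hbb : ‖-b ^ 2‖ < 1 := by simpa using norm_sq_lt_one hb
  refine ⟨hP.differentiableOn.comp hd hk, fun w hw => hP.mapsTo (hk hw), ?_, ?_, ?_, ?_⟩
  · simp only [koebeMap_zero hb, hP.map_zero]
  · intro v hv hvU
    have h1 := (hP.differentiableOn.differentiableAt (isOpen_ball.mem_nhds (hk hv))).hasDerivAt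
    have h2 := (hd.differentiableAt (isOpen_ball.mem_nhds hv)).hasDerivAt
    have h3 : HasDerivAt (fun w => P (koebeMap b w)) _ v := h1.comp v h2
    rw [h3.deriv]
    refine mul_ne_zero (hP.deriv_ne_zero _ (hk hv) hvU)
      (deriv_koebeMap_ne_zero hb (mem_ball_zero_iff.mp hv) ?_)
    intro h
    rw [h] at hvU
    exact hPb hvU
  · intro T _ hT h hc hh t₀ v hv hPv
    obtain ⟨k, kc, kb, kP, k0⟩ := hP.exists_lift T hT h hc hh t₀ _ (hk hv) hPv
    have hc' : Continuous fun t => diskMobius (-b ^ 2) (k t) :=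
      (differentiableOn_diskMobius hbb).continuousOn.comp_continuous kc kb
    obtain ⟨g, gc, gs⟩ := hT _ hc' (fun t h0 => by
      rw [diskMobius_eq_zero_iff hbb (mem_ball_zero_iff.mp (kb t))] at h0
      apply hPb
      rw [← h0, kP]
      exact hh t)
    have hg1 : ∀ t, ‖g t‖ < 1 := by
      intro t
      have h1 := norm_diskMobius_lt_one hbb (mem_ball_zero_iff.mp (kb t))
      rw [← gs, norm_pow] at h1
      nlinarith [norm_nonneg (g t)]
    -- The sign selects the square root whose lift starts at `v`.
    obtain ⟨ε, hε, hε0⟩ : ∃ ε : ℂ, ε ^ 2 = 1 ∧ ε * g t₀ = diskMobius (-b) v := by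
      have h1 := gs t₀
      rw [k0, diskMobius_koebeMap hb (mem_ball_zero_iff.mp hv), sq_eq_sq_iff_eq_or_eq_neg] at h1
      rcases h1 with h1 | h1
      · exact ⟨1, by simp, by simpa using h1⟩
      · exact ⟨-1, by simp, by simp [h1]⟩
    have hε1 : ‖ε‖ = 1 := by
      have h2 := congrArg norm hε
      rw [norm_pow, norm_one] at h2
      exact (pow_eq_one_iff_of_nonneg (norm_nonneg _) two_ne_zero).mp h2
    have hεg : ∀ t, ‖ε * g t‖ < 1 := fun t => by rw [norm_mul, hε1, one_mul]; exact hg1 t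
    refine ⟨fun t => diskMobius b (ε * g t), ?_, ?_, ?_, ?_⟩
    · exact (differentiableOn_diskMobius hb).continuousOn.comp_continuous
        (continuous_const.mul gc) (fun t => mem_ball_zero_iff.mpr (hεg t))
    · exact fun t => mem_ball_zero_iff.mpr (norm_diskMobius_lt_one hb (hεg t))
    · intro t
      simp only [koebeMap]
      rw [diskMobius_neg_diskMobius hb (hεg t), mul_pow, hε, one_mul, gs,
        ← kP t, diskMobius_diskMobius_neg (norm_sq_lt_one hb) (mem_ball_zero_iff.mp (kb t))]
    · simp only [hε0]
      exact diskMobius_diskMobius_neg hb (mem_ball_zero_iff.mp hv)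
  · intro T _ S hS k₁ k₂ c₁ c₂ b₁ b₂ hPk hU t₀ ht₀ h0
    have h1 := hP.unique T S hS (fun t => koebeMap b (k₁ t)) (fun t => koebeMap b (k₂ t))
      (hd.continuousOn.comp c₁ b₁) (hd.continuousOn.comp c₂ b₂) (fun t ht => hk (b₁ ht))
      (fun t ht => hk (b₂ ht)) hPk hU t₀ ht₀ (by simp only [h0])
    have h2 : EqOn (fun t => diskMobius (-b) (k₁ t)) (fun t => diskMobius (-b) (k₂ t)) S := by
      have hm := (differentiableOn_diskMobius hb').continuousOn
      refine hS.eq_of_sq_eq (hm.comp c₁ b₁) (hm.comp c₂ b₂) ?_ ?_ ht₀ (by simp only [h0])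
      · intro t ht
        have h3 := congrArg (diskMobius (-b ^ 2)) (h1 ht)
        simp only [diskMobius_koebeMap hb (mem_ball_zero_iff.mp (b₁ ht)),
          diskMobius_koebeMap hb (mem_ball_zero_iff.mp (b₂ ht))] at h3
        exact h3
      · intro t ht h3
        apply hPb
        have h4 := hU t ht
        rw [hPk t ht, koebeMap, h3] at h4
        simpa using h4
    intro t ht
    have h3 := congrArg (diskMobius b) (h2 ht)
    simpa only [diskMobius_diskMobius_neg hb (mem_ball_zero_iff.mp (b₁ ht)),
          diskMobius_diskMobius_neg hb (mem_ball_zero_iff.mp (b₂ ht))] using h3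

end Mobius

/-! ### Koebe's uniformization argument for planar open sets. -/

section PlanarSets
open Metric Set ComplexConjugate

/-- Lifting the identity of the disk gives a continuous section of `P`; it is holomorphic because
`P` has nonzero derivative over `U`. -/
theorem IsDiskLift.exists_local_lift {U : Set ℂ} {P : ℂ → ℂ} (hP : IsDiskLift U P) {v c : ℂ} {δ : ℝ}
    (hδ : 0 < δ) (hU : ball c δ ⊆ U) (hv : v ∈ ball (0 : ℂ) 1) (hPv : P v = c) :
    ∃ q : ℂ → ℂ, DifferentiableOn ℂ q (ball c δ) ∧ MapsTo q (ball c δ) (ball 0 1) ∧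
      (∀ z ∈ ball c δ, P (q z) = z) ∧ q c = v := by
  obtain ⟨k, kc, kb, kP, k0⟩ := hP.exists_lift (ball c δ) (hasContinuousSqrt_ball c hδ)
    (fun z => z) continuous_subtype_val (fun z => hU z.2) ⟨c, mem_ball_self hδ⟩ v hv hPv
  classical
  obtain ⟨q, hq⟩ : ∃ q : ℂ → ℂ, ∀ z (hz : z ∈ ball c δ), q z = k ⟨z, hz⟩ :=
    ⟨fun z => if hz : z ∈ ball c δ then k ⟨z, hz⟩ else 0, fun z hz => dif_pos hz⟩
  have hqc : ContinuousOn q (ball c δ) := by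
    rw [continuousOn_iff_continuous_domRestrict]
    exact kc.congr fun z => (hq z z.2).symm
  have hqb : MapsTo q (ball c δ) (ball 0 1) := fun z hz => by rw [hq z hz]; exact kb _
  have hqP : ∀ z ∈ ball c δ, P (q z) = z := fun z hz => by rw [hq z hz]; exact kP _
  refine ⟨q, fun z hz => ?_, hqb, hqP, by rw [hq c (mem_ball_self hδ), k0]⟩
  have hd := (hP.differentiableOn.differentiableAt (isOpen_ball.mem_nhds (hqb hz))).hasDerivAt
  have := HasDerivAt.of_local_left_inverse (hqc.continuousAt (isOpen_ball.mem_nhds hz)) hd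
    (hP.deriv_ne_zero _ (hqb hz) (by rw [hqP z hz]; exact hU hz))
    (Filter.eventually_of_mem (isOpen_ball.mem_nhds hz) hqP)
  exact this.differentiableAt.differentiableWithinAt

/-- Schwarz's lemma bounds the derivative at 0 of the local inverse by 1/r. This bound is what stops
the Koebe iteration. -/
theorem IsDiskLift.le_norm_deriv_zero {U : Set ℂ} {P : ℂ → ℂ} (hP : IsDiskLift U P) {r : ℝ}
    (hr : 0 < r) (hU : ball 0 r ⊆ U) : r ≤ ‖deriv P 0‖ := by
  have h0 : (0 : ℂ) ∈ ball (0 : ℂ) 1 := mem_ball_self one_pos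
  obtain ⟨q, qd, qb, qP, q0⟩ := hP.exists_local_lift hr hU h0 hP.map_zero
  have h1 : ‖deriv q 0‖ ≤ 1 / r := by
    refine Complex.norm_deriv_le_div_of_mapsTo_ball qd ?_ hr
    rw [q0]
    exact fun z hz => ball_subset_closedBall (qb hz)
  have h2 : deriv P 0 * deriv q 0 = 1 := by
    have hq := (qd.differentiableAt (isOpen_ball.mem_nhds (mem_ball_self hr))).hasDerivAt
    have hp := (hP.differentiableOn.differentiableAt (isOpen_ball.mem_nhds h0)).hasDerivAt
    rw [← q0] at hp
    have h3 := hp.comp (0 : ℂ) hq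
    rw [q0] at h3
    refine (h3.congr_of_eventuallyEq ?_).unique (hasDerivAt_id (0 : ℂ))
    exact Filter.eventually_of_mem (isOpen_ball.mem_nhds (mem_ball_self hr))
      fun z hz => (qP z hz).symm
  have h4 := congrArg norm h2
  rw [norm_mul, norm_one] at h4
  rw [le_div_iff₀ hr] at h1
  nlinarith [norm_nonneg (deriv P 0), norm_nonneg (deriv q 0),
    mul_le_mul_of_nonneg_left h1 (norm_nonneg (deriv P 0))]

/-- Iterating Koebe maps, a domain in the unit disk is covered by domains that contain arbitrarily
large disks. -/
theorem exists_isDiskLift_closedBall {U : Set ℂ} (hU : IsOpen U) (hU1 : U ⊆ ball 0 1)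
    (h0 : (0 : ℂ) ∈ U) {ρ : ℝ} (hρ1 : ρ < 1) :
    ∃ P, IsDiskLift U P ∧ ∀ v, ‖v‖ ≤ ρ → P v ∈ U := by
  by_contra! hcon
  obtain ⟨r, hr, hrU⟩ := Metric.isOpen_iff.mp hU 0 h0
  have hρ0 : 0 ≤ ρ := by
    obtain ⟨v, hv, -⟩ := hcon _ (isDiskLift_id hU1)
    exact (norm_nonneg v).trans hv
  set s := √ρ with hs
  have hs0 : 0 ≤ s := Real.sqrt_nonneg ρ
  have hss : s ^ 2 = ρ := Real.sq_sqrt hρ0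
  have hs1 : s < 1 := by nlinarith
  set κ := 2 * s / (1 + s ^ 2) with hκ
  have hκ0 : 0 ≤ κ := by positivity
  have hκ1 : κ < 1 := by
    rw [hκ, div_lt_one (by positivity)]
    nlinarith [mul_self_pos.mpr (sub_ne_zero.mpr hs1.ne)]
  -- As long as some v with |v| ≤ ρ is sent outside `U`, composing with the Koebe map whose critical
  -- value is v multiplies |P'(0)| by 2|b|/(1+|b|²) ≤ κ, where |b|² = |v|.
  have key : ∀ k : ℕ, ∃ P, IsDiskLift U P ∧ ‖deriv P 0‖ ≤ κ ^ k := by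
    intro k
    induction k with
    | zero => exact ⟨_, isDiskLift_id hU1, by simp⟩
    | succ k ih =>
      obtain ⟨P, hP, hPk⟩ := ih
      obtain ⟨v, hv, hvU⟩ := hcon P hP
      obtain ⟨b, hb⟩ := IsAlgClosed.exists_pow_nat_eq (-v) two_pos
      have hbs : ‖b‖ ≤ s := by
        apply Real.le_sqrt_of_sq_le
        rw [← norm_pow, hb, norm_neg]
        exact hv
      have hb1 : ‖b‖ < 1 := hbs.trans_lt hs1
      have hbv : -b ^ 2 = v := by rw [hb, neg_neg]
      refine ⟨_, hP.comp_koebeMap hb1 (by rwa [hbv]), ?_⟩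
      have h1 := (hP.differentiableOn.differentiableAt
        (isOpen_ball.mem_nhds (mem_ball_self one_pos))).hasDerivAt
      rw [← koebeMap_zero hb1] at h1
      have h2 := h1.comp (0 : ℂ)
        (hasDerivAt_koebeMap hb1 (w := 0) (by simp)).differentiableAt.hasDerivAt
      have h3 : deriv (fun w => P (koebeMap b w)) 0 = _ := h2.deriv
      rw [h3, koebeMap_zero hb1, norm_mul, norm_deriv_koebeMap_zero hb1, pow_succ]
      refine mul_le_mul hPk ?_ (by positivity) (pow_nonneg hκ0 k)
      rw [hκ, div_le_div_iff₀ (by positivity) (by positivity)]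
      -- Monotonicity of 2x/(1+x²) on [0,1], in the form (s − |b|)(1 − |b|s) ≥ 0.
      nlinarith [norm_nonneg b, mul_nonneg (sub_nonneg.mpr hbs)
        (sub_nonneg.mpr (mul_le_one₀ hb1.le hs0 hs1.le))]
  obtain ⟨k, hk⟩ := exists_pow_lt_of_lt_one hr hκ1
  obtain ⟨P, hP, hPk⟩ := key k
  linarith [hP.le_norm_deriv_zero hr hrU]

/-- By Schwarz–Pick the pseudohyperbolic distance from q(c) to q(z) is at most 1/2. This gives the
factor (3/4)/(1+|q(c)|)², which is at least 3/16. -/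
theorem one_sub_norm_sq_le_of_mapsTo_ball {q : ℂ → ℂ} {c z : ℂ} {δ : ℝ} (hδ : 0 < δ)
    (hq : DifferentiableOn ℂ q (ball c δ)) (hb : MapsTo q (ball c δ) (ball 0 1))
    (hz : dist z c ≤ δ / 2) : 3 / 16 * (1 - ‖q c‖ ^ 2) ≤ 1 - ‖q z‖ ^ 2 := by
  have hzb : z ∈ ball c δ := mem_ball.mpr (by linarith)
  have hu : ‖q c‖ < 1 := mem_ball_zero_iff.mp (hb (mem_ball_self hδ))
  have hw : ‖q z‖ < 1 := mem_ball_zero_iff.mp (hb hzb)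
  have h0 : diskMobius (q c) (q c) = 0 := (diskMobius_eq_zero_iff hu hu).mpr rfl
  have h1 : ‖diskMobius (q c) (q z)‖ ≤ 1 / 2 := by
    have h2 := Complex.dist_le_div_mul_dist_of_mapsTo_ball (R₂ := 1)
      ((differentiableOn_diskMobius hu).comp hq hb)
      (fun y hy => by
        rw [Function.comp_apply, Function.comp_apply, h0]
        exact ball_subset_closedBall (mapsTo_diskMobius hu (hb hy))) hzb
    rw [Function.comp_apply, Function.comp_apply, h0, dist_zero_right] at h2
    refine h2.trans ?_
    rw [div_mul_eq_mul_div, one_mul, div_le_iff₀ hδ]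
    linarith
  have h2 := one_sub_normSq_diskMobius hu hw
  have h3 := one_sub_conj_mul_ne_zero hu hw
  have h4 : 1 - ‖q c‖ ≤ ‖1 - conj (q c) * q z‖ := by
    have h5 := norm_sub_norm_le (1 : ℂ) (conj (q c) * q z)
    rw [norm_mul, RCLike.norm_conj, norm_one] at h5
    nlinarith [norm_nonneg (q c)]
  have h6 : 3 / 4 * ‖1 - conj (q c) * q z‖ ^ 2 ≤ (1 - ‖q c‖ ^ 2) * (1 - ‖q z‖ ^ 2) := by
    rw [← le_div_iff₀ (by positivity), ← h2]
    nlinarith [norm_nonneg (diskMobius (q c) (q z))]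
  set x := ‖q c‖
  have hx0 : 0 ≤ x := norm_nonneg _
  have h7 : 3 / 4 * (1 - x) ^ 2 ≤ (1 - x ^ 2) * (1 - ‖q z‖ ^ 2) := by
    refine le_trans ?_ h6
    have : (1 - x) ^ 2 ≤ ‖1 - conj (q c) * q z‖ ^ 2 := pow_le_pow_left₀ (by linarith) h4 2
    linarith
  have h8 : 3 / 4 * (1 - x) ≤ (1 + x) * (1 - ‖q z‖ ^ 2) := by
    have : 0 < 1 - x := by linarith
    refine le_of_mul_le_mul_left ?_ this
    linarith
  have h9 : 0 ≤ 1 - ‖q z‖ ^ 2 := by nlinarith [norm_nonneg (q z)]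
  nlinarith

/-- The point is that ε precedes P. By compactness, f along each ray from 0 crosses n disks of a
radius δ that fit in `U`, with n and δ depending only on f and `U`; each crossing costs the lift a
factor 3/16. -/
theorem exists_norm_le_of_isDiskLift {N : Type} [Fintype N] {U : Set ℂ} (hU : IsOpen U)
    {f : (N → unitInterval) → ℂ} (hf : Continuous f) (hfU : ∀ t, f t ∈ U) :
    ∃ ε > 0, ∀ P, IsDiskLift U P → ∀ k : (N → unitInterval) → ℂ, Continuous k →
      (∀ t, k t ∈ ball (0 : ℂ) 1) → (∀ t, P (k t) = f t) → k 0 = 0 →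
      ∀ t, ε ≤ 1 - ‖k t‖ ^ 2 := by
  obtain ⟨δ, hδ, hδU⟩ := (isCompact_range hf).exists_thickening_subset_open hU
    (range_subset_iff.mpr hfU)
  have hball : ∀ t, ball (f t) δ ⊆ U := fun t =>
    (ball_subset_thickening (mem_range_self t) δ).trans hδU
  let G : unitInterval × (N → unitInterval) → ℂ := fun p => f (fun i => p.1 * p.2 i)
  have hG : Continuous G := hf.comp (continuous_pi fun i =>
    continuous_fst.mul ((continuous_apply i).comp continuous_snd))
  obtain ⟨η, hη, hGη⟩ := Metric.uniformContinuous_iff.mp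
    (CompactSpace.uniformContinuous_of_continuous hG) (δ / 2) (by linarith)
  obtain ⟨n, hn⟩ := exists_nat_gt (1 / η)
  have hn0 : (0 : ℝ) < n := lt_trans (by positivity) hn
  refine ⟨(3 / 16) ^ n, by positivity, fun P hP k hk hkb hkP hk0 t => ?_⟩
  let σ : ℝ → unitInterval := projIcc 0 1 zero_le_one
  have hσ : Continuous σ := continuous_projIcc
  let γ : ℝ → (N → unitInterval) := fun s i => σ s * t i
  have hγ : Continuous γ := continuous_pi fun i => hσ.mul continuous_const
  have hstep : ∀ s s' : ℝ, |s - s'| ≤ 1 / n → dist (f (γ s)) (f (γ s')) < δ / 2 := by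
    intro s s' hs
    refine hGη (a := (σ s, t)) (b := (σ s', t)) ?_
    rw [Prod.dist_eq, dist_self, max_eq_left dist_nonneg]
    refine lt_of_le_of_lt (((LipschitzWith.projIcc (zero_le_one (α := ℝ))).dist_le_mul s s').trans
      ?_) ((one_div_lt hη hn0).mp hn)
    simpa [Real.dist_eq] using hs
  have key : ∀ j : ℕ, (3 / 16 : ℝ) ^ j ≤ 1 - ‖k (γ (j / n))‖ ^ 2 := by
    intro j
    induction j with
    | zero =>
      have : γ ((0 : ℕ) / n) = 0 := by
        funext i
        simp [γ, σ]
      rw [this, hk0]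
      simp
    | succ j ih =>
      set a : ℝ := j / n
      set b : ℝ := ((j + 1 : ℕ) : ℝ) / n
      have hab : b - a = 1 / n := by simp only [a, b]; push_cast; ring
      have hab' : a ≤ b := by have : 0 < 1 / (n : ℝ) := by positivity
                              linarith
      obtain ⟨q, qd, qb, qP, qc⟩ := hP.exists_local_lift hδ (hball (γ a)) (hkb (γ a)) (hkP _)
      have hmem : ∀ s ∈ Icc a b, f (γ s) ∈ ball (f (γ a)) δ := by
        intro s hs
        have := hstep s a (by rw [abs_of_nonneg (by linarith [hs.1])]; linarith [hs.2])
        exact mem_ball.mpr (by linarith)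
      -- On this piece of the ray the lift is the local inverse composed with f, so the Schwarz–Pick
      -- estimate applies to it.
      have heq := hP.unique ℝ (Icc a b) isPreconnected_Icc (fun s => q (f (γ s)))
        (fun s => k (γ s)) (qd.continuousOn.comp (hf.comp hγ).continuousOn hmem)
        (hk.comp hγ).continuousOn (fun s hs => qb (hmem s hs)) (fun s _ => hkb _)
        (fun s hs => by rw [qP _ (hmem s hs), hkP]) (fun s hs => by rw [qP _ (hmem s hs)]; exact hfU _)
        a ⟨le_rfl, hab'⟩ qc
      have hb := heq (right_mem_Icc.mpr hab')
      have h1 := one_sub_norm_sq_le_of_mapsTo_ball hδ qd qb (z := f (γ b))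
        (hstep b a (by rw [hab, abs_of_nonneg (by positivity)])).le
      simp only at hb
      rw [hb, qc] at h1
      rw [pow_succ']
      linarith
  have h1 := key n
  rw [div_self hn0.ne'] at h1
  have h2 : γ 1 = t := by
    funext i
    simp [γ, σ]
  rwa [h2] at h1

/-- Every face meets a face {z j = 0} in another direction, and the latter contains 0. This is where
dimension at least two enters. -/
theorem isPreconnected_cubeBoundary (N : Type) [Nontrivial N] :
    IsPreconnected (Cube.boundary N) := by
  classical
  have face : ∀ (i : N) (e : unitInterval), IsPreconnected {y : N → unitInterval | y i = e} := by
    intro i e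
    have h1 : {y : N → unitInterval | y i = e} =
        (fun y : N → unitInterval => Function.update y i e) '' univ := by
      ext y
      constructor
      · rintro rfl
        exact ⟨y, mem_univ _, by simp⟩
      · rintro ⟨y, -, rfl⟩
        simp
    rw [h1]
    exact isPreconnected_univ.image _ (by fun_prop)
  refine isPreconnected_of_forall 0 ?_
  rintro y ⟨i, hi⟩
  obtain ⟨j, hj⟩ := exists_ne i
  refine ⟨{z | z i = y i} ∪ {z | z j = 0}, ?_, Or.inr rfl, Or.inl rfl, ?_⟩
  · rintro z (hz | hz)
    · exact ⟨i, by rwa [show z i = y i from hz]⟩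
    · exact ⟨j, Or.inl hz⟩
  · exact (face i (y i)).union (Function.update (0 : N → unitInterval) i (y i)) (by simp) (by simp [hj]) (face j 0)

theorem exists_factorization_of_subset_ball {N : Type} [Fintype N] [Nontrivial N] {U : Set ℂ}
    (hU : IsOpen U) (hU1 : U ⊆ ball 0 1) {f : (N → unitInterval) → ℂ} (hf : Continuous f)
    (hfU : ∀ t, f t ∈ U) (hf0 : ∀ t ∈ Cube.boundary N, f t = 0) :
    ∃ (P : ℂ → ℂ) (r : ℝ) (k : (N → unitInterval) → ℂ), 0 < r ∧ ContinuousOn P (ball 0 r) ∧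
      (∀ v ∈ ball (0 : ℂ) r, P v ∈ U) ∧ Continuous k ∧ (∀ t, k t ∈ ball (0 : ℂ) r) ∧
      (∀ t, P (k t) = f t) ∧ ∀ t ∈ Cube.boundary N, k t = 0 := by
  obtain ⟨ε, hε, hbound⟩ := exists_norm_le_of_isDiskLift hU hf hfU
  have hz : (0 : N → unitInterval) ∈ Cube.boundary N :=
    ⟨Classical.arbitrary N, Or.inl rfl⟩
  have h0U : (0 : ℂ) ∈ U := hf0 0 hz ▸ hfU 0
  -- Halving ε keeps the lift strictly inside radius r. As ε does not depend on P, the map P can now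
  -- be chosen to send the disk of radius r into `U`.
  set r := √(max 0 (1 - ε / 2)) with hr
  have hr1 : r < 1 := by
    rw [hr, Real.sqrt_lt' one_pos]
    exact max_lt (by norm_num) (by linarith)
  obtain ⟨P, hP, hPU⟩ := exists_isDiskLift_closedBall hU hU1 h0U hr1
  obtain ⟨k, kc, kb, kP, k0⟩ := hP.exists_lift _ (hasContinuousSqrt_cube N) f hf hfU 0 0
    (mem_ball_self one_pos) (by rw [hP.map_zero, hf0 0 hz])
  have hkr : ∀ t, ‖k t‖ < r := by
    intro t
    have h1 := hbound P hP k kc kb kP k0 t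
    apply Real.lt_sqrt_of_sq_lt
    exact lt_of_lt_of_le (by linarith) (le_max_right _ _)
  refine ⟨P, r, k, (norm_nonneg _).trans_lt (hkr 0),
    hP.differentiableOn.continuousOn.mono (ball_subset_ball hr1.le),
    fun v hv => hPU v (mem_ball_zero_iff.mp hv).le, kc, fun t => mem_ball_zero_iff.mpr (hkr t), kP,
    ?_⟩
  -- On the connected boundary the lift is compared with the constant lift 0.
  exact hP.unique _ _ (isPreconnected_cubeBoundary N) k (fun _ => 0) kc.continuousOn
    continuousOn_const (fun t _ => kb t) (fun t _ => mem_ball_self one_pos)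
    (fun t ht => by rw [kP, hf0 t ht, hP.map_zero]) (fun t _ => by rw [kP]; exact hfU t) 0 hz k0

/-- A map from a cube of dimension at least two to an open subset `U` of the plane that is constant
on the boundary factors through a map of the plane to `U`. -/
theorem exists_factorization_of_isOpen {N : Type} [Fintype N] [Nontrivial N] {U : Set ℂ}
    (hU : IsOpen U) {f : (N → unitInterval) → ℂ} (hf : Continuous f)
    (hfU : ∀ t, f t ∈ U) {c : ℂ} (hfc : ∀ t ∈ Cube.boundary N, f t = c) :
    ∃ (P : ℂ → ℂ) (k : (N → unitInterval) → ℂ), Continuous P ∧ (∀ v, P v ∈ U) ∧ Continuous k ∧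
      (∀ t, P (k t) = f t) ∧ ∀ t ∈ Cube.boundary N, k t = 0 := by
  -- Translating c to 0 and shrinking the plane to the unit disk reduces to the bounded case; only
  -- the topology of `U` matters here.
  let e : ℂ ≃ₜ ball (0 : ℂ) 1 := Homeomorph.unitBall
  have he0 : (e 0 : ℂ) = 0 := Homeomorph.coe_unitBall_apply_zero
  let U' : Set ℂ := (fun z => (e z : ℂ)) '' {z | z + c ∈ U}
  have hU' : IsOpen U' :=
    (isOpen_ball.isOpenEmbedding_subtypeVal.comp e.isOpenEmbedding).isOpenMap _
      (hU.preimage (by fun_prop))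
  have hU1 : U' ⊆ ball 0 1 := by rintro _ ⟨z, -, rfl⟩; exact (e z).2
  obtain ⟨P, r, k, hr, Pc, PU, kc, kr, kP, k0⟩ := exists_factorization_of_subset_ball hU' hU1
    (f := fun t => e (f t - c))
    (continuous_subtype_val.comp (e.continuous.comp (hf.sub continuous_const)))
    (fun t => ⟨f t - c, by simpa using hfU t, rfl⟩) (fun t ht => by rw [hfc t ht, sub_self, he0])
  have hscale : ∀ z, (r : ℂ) * e z ∈ ball (0 : ℂ) r := by
    intro z
    have h1 := mem_ball_zero_iff.mp (e z).2
    rw [mem_ball_zero_iff, norm_mul, Complex.norm_real, Real.norm_of_nonneg hr.le]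
    nlinarith
  have hscale' : ∀ t, k t / r ∈ ball (0 : ℂ) 1 := by
    intro t
    have h1 := mem_ball_zero_iff.mp (kr t)
    rw [mem_ball_zero_iff, norm_div, Complex.norm_real, Real.norm_of_nonneg hr.le]
    rwa [div_lt_one hr]
  have hrc : (r : ℂ) ≠ 0 := by exact_mod_cast hr.ne'
  refine ⟨fun z => e.symm ⟨P (r * e z), hU1 (PU _ (hscale z))⟩ + c,
    fun t => e.symm ⟨k t / r, hscale' t⟩, ?_, ?_, ?_, ?_, ?_⟩
  · refine (e.symm.continuous.comp (Continuous.subtype_mk ?_ _)).add continuous_const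
    exact Pc.comp_continuous (by fun_prop) hscale
  · intro v
    obtain ⟨z, hz, hzv⟩ := PU _ (hscale v)
    have : (⟨P (r * e v), hU1 (PU _ (hscale v))⟩ : ball (0 : ℂ) 1) = e z := Subtype.ext hzv.symm
    simp only [this, e.symm_apply_apply]
    exact hz
  · exact e.symm.continuous.comp (Continuous.subtype_mk (kc.div_const _) _)
  · intro t
    have : (⟨P (r * e (e.symm ⟨k t / r, hscale' t⟩)), hU1 (PU _ (hscale _))⟩ : ball (0 : ℂ) 1) =
        e (f t - c) := by
      apply Subtype.ext
      simp only [e.apply_symm_apply]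
      rw [mul_div_cancel₀ _ hrc, kP]
    simp only [this, e.symm_apply_apply, sub_add_cancel]
  · intro t ht
    rw [e.symm_apply_eq]
    apply Subtype.ext
    simp [k0 t ht, he0]

end PlanarSets

namespace PlaneCurve

/-! ### Squarefreeness of the equation. -/

section Reduced
open MvPolynomial

variable {q : MvPolynomial (Fin 3) ℂ}

theorem not_dvd_X_of_dvd_X (hq : Irreducible q) {i j : Fin 3} (hij : i ≠ j)
    (hi : q ∣ X i) : ¬ q ∣ X j := by
  intro hj
  have h1 : X i ∣ q := (hq.associated_of_dvd X_prime.irreducible hi).dvd'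
  have h2 : (X i : MvPolynomial (Fin 3) ℂ) ∣ X j := h1.trans hj
  rw [X_dvd_X] at h2
  exact hij h2

theorem dvd_pderiv_of_mul_self_dvd {F : MvPolynomial (Fin 3) ℂ} (i : Fin 3) (h : q * q ∣ F) :
    q ∣ pderiv i F := by
  obtain ⟨g, rfl⟩ := h
  simp only [Derivation.leibniz, smul_eq_mul]
  exact ⟨q * pderiv i g + 2 * g * pderiv i q, by ring⟩

theorem dvd_of_dvd_natCast_mul {m : ℕ} (hm : m ≠ 0)
    {F : MvPolynomial (Fin 3) ℂ} (h : q ∣ (m : MvPolynomial (Fin 3) ℂ) * F) : q ∣ F := by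
  have hu : IsUnit (m : MvPolynomial (Fin 3) ℂ) := by
    rw [← map_natCast (C : ℂ →+* MvPolynomial (Fin 3) ℂ)]
    exact (IsUnit.mk0 (m : ℂ) (by exact_mod_cast hm)).map C
  exact hu.dvd_mul_left.mp h

theorem dvd_X_of_dvd_X_pow_add (hq : Irreducible q) {m : ℕ} {i j : Fin 3}
    (h : q ∣ X i ^ m + X j ^ m) (hi : q ∣ X i) (hm : m ≠ 0) : q ∣ X j :=
  hq.prime.dvd_of_dvd_pow ((dvd_add_right (hi.pow hm)).mp h)

theorem squarefree_X_pow_add_X_pow {m : ℕ} (hm : m ≠ 0) {i j : Fin 3} (hij : i ≠ j) :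
    Squarefree (X i ^ m + X j ^ m : MvPolynomial (Fin 3) ℂ) := by
  rw [squarefree_iff_irreducible_sq_not_dvd_of_exists_irreducible ⟨X 0, X_prime (i := (0 : Fin 3)).irreducible⟩]
  intro q hq h
  have h1 := dvd_pderiv_of_mul_self_dvd i h
  have h2 : pderiv i (X i ^ m + X j ^ m : MvPolynomial (Fin 3) ℂ) =
      (m : MvPolynomial (Fin 3) ℂ) * X i ^ (m - 1) := by
    simp [Derivation.leibniz_pow, pderiv_X_of_ne hij.symm]
  rw [h2] at h1
  have h3 := hq.prime.dvd_of_dvd_pow (dvd_of_dvd_natCast_mul hm h1)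
  exact not_dvd_X_of_dvd_X hq hij h3
    (dvd_X_of_dvd_X_pow_add hq ((dvd_mul_left q q).trans h) h3 hm)

/-- The elementary symmetric polynomial of degree two in the `m`-th powers of the variables. -/
noncomputable def pairProducts (m : ℕ) : MvPolynomial (Fin 3) ℂ :=
  X 0 ^ m * X 1 ^ m + X 1 ^ m * X 2 ^ m + X 0 ^ m * X 2 ^ m

theorem dvd_X_or_dvd_X_of_dvd_mul_pow (hq : Irreducible q) {m : ℕ} {i j : Fin 3}
    (h : q ∣ X i ^ m * X j ^ m) : q ∣ X i ∨ q ∣ X j :=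
  (hq.prime.dvd_or_dvd h).imp hq.prime.dvd_of_dvd_pow hq.prime.dvd_of_dvd_pow

theorem squarefree_pairProducts {m : ℕ} (hm : m ≠ 0) : Squarefree (pairProducts m) := by
  rw [squarefree_iff_irreducible_sq_not_dvd_of_exists_irreducible ⟨X 0, X_prime (i := (0 : Fin 3)).irreducible⟩]
  intro q hq h
  have hG : q ∣ pairProducts m := (dvd_mul_left q q).trans h
  have hpow : ∀ i : Fin 3, (X i * X i ^ (m - 1) : MvPolynomial (Fin 3) ℂ) = X i ^ m :=
    fun i => mul_pow_sub_one hm _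
  -- The Euler operator X_i ∂_i isolates the terms containing X_i, so q divides the remaining term.
  -- The three choices of i make q divide every pairwise product, hence two of the variables.
  have key : ∀ i : Fin 3, ∀ A B : MvPolynomial (Fin 3) ℂ, pderiv i A = 0 → pderiv i B = 0 →
      pairProducts m = X i ^ m * A + B → q ∣ B := by
    intro i A B hA hB hAB
    have h1 := (dvd_pderiv_of_mul_self_dvd i h).mul_left (X i)
    have h2 : X i * pderiv i (pairProducts m) =
        (m : MvPolynomial (Fin 3) ℂ) * (X i ^ m * A) := by
      rw [hAB, ← hpow i]
      simp only [hpow i, map_add, hB, Derivation.leibniz, Derivation.leibniz_pow, hA, pderiv_X_self,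
        smul_eq_mul, nsmul_eq_mul]
      rw [← hpow i]
      ring
    rw [h2] at h1
    exact (dvd_add_right (dvd_of_dvd_natCast_mul hm h1)).mp (hAB ▸ hG)
  have h0 := key 0 (X 1 ^ m + X 2 ^ m) (X 1 ^ m * X 2 ^ m)
    (by simp [Derivation.leibniz_pow])
    (by simp [Derivation.leibniz, Derivation.leibniz_pow])
    (by rw [pairProducts]; ring)
  have h1 := key 1 (X 0 ^ m + X 2 ^ m) (X 0 ^ m * X 2 ^ m)
    (by simp [Derivation.leibniz_pow])
    (by simp [Derivation.leibniz, Derivation.leibniz_pow])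
    (by rw [pairProducts]; ring)
  have h2 := key 2 (X 0 ^ m + X 1 ^ m) (X 0 ^ m * X 1 ^ m)
    (by simp [Derivation.leibniz_pow])
    (by simp [Derivation.leibniz, Derivation.leibniz_pow])
    (by rw [pairProducts]; ring)
  have n01 := not_dvd_X_of_dvd_X hq (show (0 : Fin 3) ≠ 1 by decide)
  have n02 := not_dvd_X_of_dvd_X hq (show (0 : Fin 3) ≠ 2 by decide)
  have n12 := not_dvd_X_of_dvd_X hq (show (1 : Fin 3) ≠ 2 by decide)
  have d0 := dvd_X_or_dvd_X_of_dvd_mul_pow hq h0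
  have d1 := dvd_X_or_dvd_X_of_dvd_mul_pow hq h1
  have d2 := dvd_X_or_dvd_X_of_dvd_mul_pow hq h2
  tauto

theorem isRelPrime_of_irreducible {F G : MvPolynomial (Fin 3) ℂ} (hF : F ≠ 0)
    (h : ∀ q : MvPolynomial (Fin 3) ℂ, Irreducible q → q ∣ F → ¬ q ∣ G) : IsRelPrime F G :=
  WfDvdMonoid.isRelPrime_of_no_irreducible_factors (fun h0 => hF h0.1) h

theorem squarefree_curve {m : ℕ} (hm : m ≠ 0) : Squarefree (curve m) := by
  have hX : ∀ i : Fin 3, Squarefree (X i : MvPolynomial (Fin 3) ℂ) := fun i =>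
    X_prime.irreducible.squarefree
  have h12 : (1 : Fin 3) ≠ 2 := by decide
  have hyz : Squarefree (X 1 * X 2 : MvPolynomial (Fin 3) ℂ) :=
    squarefree_mul_iff.mpr ⟨isRelPrime_of_irreducible (X_ne_zero 1)
      fun q hq => not_dvd_X_of_dvd_X hq h12, hX 1, hX 2⟩
  have hG := squarefree_pairProducts hm
  have hyzG : Squarefree (X 1 * X 2 * pairProducts m) := by
    refine squarefree_mul_iff.mpr ⟨isRelPrime_of_irreducible hyz.ne_zero fun q hq h h' => ?_,
      hyz, hG⟩
    have n10 := not_dvd_X_of_dvd_X hq (show (1 : Fin 3) ≠ 0 by decide)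
    have n20 := not_dvd_X_of_dvd_X hq (show (2 : Fin 3) ≠ 0 by decide)
    have n12 := not_dvd_X_of_dvd_X hq h12
    rcases hq.prime.dvd_or_dvd h with h | h
    · have h1 : q ∣ X 0 ^ m * X 2 ^ m := by
        refine (dvd_add_right ((h.pow hm).mul_right (X 0 ^ m + X 2 ^ m))).mp ?_
        convert h' using 1
        rw [pairProducts]; ring
      have := dvd_X_or_dvd_X_of_dvd_mul_pow hq h1
      tauto
    · have h1 : q ∣ X 0 ^ m * X 1 ^ m := by
        refine (dvd_add_right ((h.pow hm).mul_right (X 0 ^ m + X 1 ^ m))).mp ?_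
        convert h' using 1
        rw [pairProducts]; ring
      have := dvd_X_or_dvd_X_of_dvd_mul_pow hq h1
      tauto
  refine squarefree_mul_iff.mpr ⟨isRelPrime_of_irreducible hyzG.ne_zero fun q hq h h' => ?_,
      hyzG, squarefree_X_pow_add_X_pow hm h12⟩
  have n12 := not_dvd_X_of_dvd_X hq h12
  have a12 := fun h => dvd_X_of_dvd_X_pow_add hq h' h hm
  have a21 := fun h => dvd_X_of_dvd_X_pow_add hq ((add_comm _ _).subst h' :
    q ∣ X 2 ^ m + X 1 ^ m) h hm
  -- Modulo y^m + z^m the factor `pairProducts m` is y^m z^m.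
  have key : q ∣ X 1 ∨ q ∣ X 2 := by
    rcases hq.prime.dvd_or_dvd h with h | h
    · exact hq.prime.dvd_or_dvd h
    · refine dvd_X_or_dvd_X_of_dvd_mul_pow (m := m) hq ?_
      refine (dvd_add_right (h'.mul_left (X 0 ^ m))).mp ?_
      have e : pairProducts m = X 0 ^ m * (X 1 ^ m + X 2 ^ m) + X 1 ^ m * X 2 ^ m := by
        rw [pairProducts]; ring
      rwa [← e]
  tauto

theorem isHomogeneous_curve (m : ℕ) : (curve m).IsHomogeneous (1 + 1 + (m + m) + m) := by
  have hX := fun i : Fin 3 => isHomogeneous_X ℂ i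
  have hp : ∀ i : Fin 3, (X i ^ m : MvPolynomial (Fin 3) ℂ).IsHomogeneous m :=
    fun i => by simpa using (hX i).pow m
  exact (((hX 1).mul (hX 2)).mul ((((hp 0).mul (hp 1)).add ((hp 1).mul (hp 2))).add
    ((hp 0).mul (hp 2)))).mul ((hp 1).add (hp 2))

theorem isReducedCurve_curve {m : ℕ} (hm : m ≠ 0) : IsReducedCurve (curve m) :=
  ⟨⟨_, by omega, isHomogeneous_curve m⟩, squarefree_curve hm⟩

end Reduced

end PlaneCurve

namespace PlaneCurve

/-! ### Asphericity and local triviality of the affine model. -/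

section AffineModel
open Set

/-- The complement of the curve in the affine coordinates `(x / y, y / z)`. -/
def affineModel (m : ℕ) : Set (ℂ × ℂ) :=
  {p | p.2 ≠ 0 ∧ 1 + p.2 ^ m ≠ 0 ∧ p.1 ^ m * (1 + p.2 ^ m) + 1 ≠ 0}

/-- The complement of zero and of the `m`-th roots of `-1`. -/
def affineBase (m : ℕ) : Set ℂ := {y | y ≠ 0 ∧ 1 + y ^ m ≠ 0}

theorem isOpen_affineBase (m : ℕ) : IsOpen (affineBase m) :=
  isOpen_ne.inter (isOpen_ne_fun (by fun_prop) continuous_const)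

/-- The base and the fibres are complements of finite sets in ℂ, and the section w = 0 meets every
fibre. -/
theorem pathConnectedSpace_affineModel {m : ℕ} (hm : m ≠ 0) : PathConnectedSpace (affineModel m) := by
  have hfin : ∀ a : ℂ, {w : ℂ | w ^ m = a}.Finite := by
    intro a
    refine (Polynomial.nthRoots m a).toFinset.finite_toSet.subset fun w hw => ?_
    simpa [Polynomial.mem_nthRoots (Nat.pos_of_ne_zero hm)] using hw
  have hrank : 1 < Module.rank ℝ ℂ := by simp [Complex.rank_real_complex]
  rw [← isPathConnected_iff_pathConnectedSpace]
  have hB : IsPathConnected (affineBase m) := by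
    have h1 := (((hfin (-1)).insert 0).countable).isPathConnected_compl_of_one_lt_rank hrank
    convert h1 using 1
    ext y
    simp [affineBase, eq_neg_iff_add_eq_zero, add_comm]
  have hF : ∀ p ∈ affineModel m, JoinedIn (affineModel m) p (0, p.2) := by
    rintro ⟨w, y⟩ ⟨h0, h1, h2⟩
    have h3 := ((hfin (-1 / (1 + y ^ m))).countable).isPathConnected_compl_of_one_lt_rank hrank
    have hmem : ∀ v : ℂ, v ^ m * (1 + y ^ m) + 1 ≠ 0 → v ∈ {w : ℂ | w ^ m = -1 / (1 + y ^ m)}ᶜ := by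
      intro v hv hv'
      apply hv
      rw [show v ^ m = _ from hv', div_mul_cancel₀ _ h1]
      ring
    have h4 := (h3.joinedIn w (hmem w h2) 0 (hmem 0 (by simp [hm]))).map
      (f := fun v : ℂ => (v, y)) (by fun_prop)
    refine h4.mono ?_
    rintro _ ⟨v, hv, rfl⟩
    refine ⟨h0, h1, fun h5 => hv ?_⟩
    rw [mem_ofPred_eq, eq_div_iff h1, eq_neg_iff_add_eq_zero]
    exact h5
  have hS : ∀ y ∈ affineBase m, ∀ y' ∈ affineBase m, JoinedIn (affineModel m) (0, y) (0, y') := by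
    intro y hy y' hy'
    refine ((hB.joinedIn y hy y' hy').map (f := fun v : ℂ => ((0 : ℂ), v))
      (by fun_prop)).mono ?_
    rintro _ ⟨v, hv, rfl⟩
    exact ⟨hv.1, hv.2, by simp [hm]⟩
  obtain ⟨y₀, hy₀⟩ := hB.nonempty
  refine ⟨(0, y₀), ⟨hy₀.1, hy₀.2, by simp [hm]⟩, fun {p} hp => ?_⟩
  exact (hS y₀ hy₀ p.2 ⟨hp.1, hp.2.1⟩).trans (hF p hp).symm

/-- Scaling k linearly to 0 contracts the loop, and the boundary stays fixed because k already
vanishes there. -/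
theorem homotopic_const_of_factorization {N Z : Type} [TopologicalSpace Z] {x : Z}
    (f : GenLoop N Z x) (Φ : ℂ × ℂ → Z) (hΦ : Continuous Φ) (k : (N → unitInterval) → ℂ × ℂ)
    (hk : Continuous k) (hf : ∀ t, Φ (k t) = f t) (hk0 : ∀ t ∈ Cube.boundary N, k t = 0)
    (hx : Φ 0 = x) : GenLoop.Homotopic f GenLoop.const := by
  refine ⟨⟨⟨⟨fun p => Φ (((1 - (p.1 : ℝ) : ℝ) : ℂ) • k p.2), ?_⟩, ?_, ?_⟩, ?_⟩⟩
  · fun_prop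
  · intro t
    simp [hf]
  · intro t
    simp [hx]
  · intro s t ht
    have := GenLoop.boundary f t ht
    simp [hk0 t ht, hx, this]

theorem homotopic_const_affineModel {m : ℕ} (hm : m ≠ 0) {N : Type} [Fintype N] [Nontrivial N]
    {x : affineModel m} (f : GenLoop N (affineModel m) x) : GenLoop.Homotopic f GenLoop.const := by
  have hfc : Continuous f := f.1.continuous
  have hfx : ∀ t ∈ Cube.boundary N, f t = x := GenLoop.boundary f
  have hz : (0 : N → unitInterval) ∈ Cube.boundary N :=
    ⟨Classical.arbitrary N, Or.inl rfl⟩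
  obtain ⟨P, k, Pc, PU, kc, kP, k0⟩ := exists_factorization_of_isOpen (isOpen_affineBase m)
    (f := fun t => (f t).1.2) (by fun_prop) (fun t => ⟨(f t).2.1, (f t).2.2.1⟩)
    (c := x.1.2) (fun t ht => by rw [hfx t ht])
  -- On the base itself 1 + s^m has in general no continuous m-th root; its pullback to the plane
  -- has one.
  obtain ⟨u, uc, um⟩ := exists_continuous_root hm (h := fun v => 1 + P v ^ m) (by fun_prop)
    (fun v => (PU v).2)
  have u0 : ∀ v, u v ≠ 0 := by
    intro v hv
    apply (PU v).2
    rw [← um, hv, zero_pow hm]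
  have hopen : IsOpen {t : ℂ | t ^ m + 1 ≠ 0} := isOpen_ne_fun (by fun_prop) continuous_const
  obtain ⟨Q, l, Qc, QU, lc, lQ, l0⟩ := exists_factorization_of_isOpen hopen
    (f := fun t => (f t).1.1 * u (k t)) (by fun_prop)
    (fun t => by
      have := (f t).2.2.2
      rw [← kP t] at this
      rwa [mem_ofPred_eq, mul_pow, um])
    (c := x.1.1 * u 0) (fun t ht => by simp only [hfx t ht, k0 t ht])
  let Φ : ℂ × ℂ → affineModel m := fun v => ⟨(Q v.2 / u v.1, P v.1), (PU v.1).1, (PU v.1).2, by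
    have h := QU v.2
    rw [← um, div_pow, div_mul_cancel₀ _ (pow_ne_zero m (u0 v.1))]
    exact h⟩
  have hΦf : ∀ t, Φ (k t, l t) = f t := by
    intro t
    apply Subtype.ext
    simp only [Φ, lQ, kP, mul_div_cancel_right₀ _ (u0 (k t))]
  refine homotopic_const_of_factorization f Φ ?_ (fun t => (k t, l t)) (kc.prodMk lc) hΦf
    (fun t ht => by simp [k0 t ht, l0 t ht]) ?_
  · exact Continuous.subtype_mk (((Qc.comp continuous_snd).div (uc.comp continuous_fst)
      fun v => u0 v.1).prodMk (Pc.comp continuous_fst)) _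
  · have := hΦf 0
    rw [k0 0 hz, l0 0 hz, hfx 0 hz] at this
    exact this

theorem subsingleton_homotopyGroup_affineModel {m : ℕ} (hm : m ≠ 0) {n : ℕ} (hn : 2 ≤ n)
    (x : affineModel m) : Subsingleton (HomotopyGroup (Fin n) (affineModel m) x) := by
  have : Nontrivial (Fin n) := Fin.nontrivial_iff_two_le.mpr hn
  refine subsingleton_of_forall_eq (Quotient.mk _ GenLoop.const) fun a => ?_
  induction a using Quotient.inductionOn with
  | h f => exact Quotient.sound (homotopic_const_affineModel hm f)

theorem isKPiOne_affineModel {m : ℕ} (hm : m ≠ 0) : IsKPiOne (affineModel m) :=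
  ⟨pathConnectedSpace_affineModel hm, fun _ hn x => subsingleton_homotopyGroup_affineModel hm hn x⟩

theorem IsKPiOne.of_homeomorph {E E' : Type} [TopologicalSpace E] [TopologicalSpace E']
    (h : E ≃ₜ E') (hE : IsKPiOne E') : IsKPiOne E := by
  have := hE.1
  refine ⟨h.symm.surjective.pathConnectedSpace h.symm.continuous, fun n hn x => ?_⟩
  refine subsingleton_of_forall_eq (Quotient.mk _ GenLoop.const) fun a => ?_
  induction a using Quotient.inductionOn with
  | h f =>
    have := hE.2 n hn (h x)
    let g : GenLoop (Fin n) E' (h x) := ⟨(h : C(E, E')).comp f.1, fun t ht => by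
      simp [GenLoop.boundary f t ht]⟩
    obtain ⟨H⟩ : GenLoop.Homotopic g GenLoop.const :=
      Quotient.exact (Subsingleton.elim (α := HomotopyGroup (Fin n) E' (h x))
        (Quotient.mk _ g) (Quotient.mk _ GenLoop.const))
    refine Quotient.sound ⟨⟨⟨⟨fun p => h.symm (H p), by fun_prop⟩, ?_, ?_⟩, ?_⟩⟩
    · intro t
      simp [g]
    · intro t
      simp
    · intro s t ht
      have := H.prop s t ht
      simp [g] at this
      simp [this]

theorem IsLocallyTrivialFibration.of_homeomorph {E E' B B' : Type} [TopologicalSpace E]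
    [TopologicalSpace E'] [TopologicalSpace B] [TopologicalSpace B'] {f : E → B} {f' : E' → B'}
    (hE : E ≃ₜ E') (hB : B ≃ₜ B') (hf : ∀ p, hB (f p) = f' (hE p))
    (h : IsLocallyTrivialFibration f') : IsLocallyTrivialFibration f := by
  obtain ⟨Y, hY, h⟩ := h
  refine ⟨Y, hY, fun b => ?_⟩
  obtain ⟨e, he⟩ := h (hB b)
  let φ := (hE.toOpenPartialHomeomorph.trans e.toOpenPartialHomeomorph).trans
    (hB.symm.prodCongr (Homeomorph.refl Y)).toOpenPartialHomeomorph
  have hs : φ.source = f ⁻¹' (hB ⁻¹' e.baseSet) := by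
    ext p
    simp [φ, e.source_eq, hf]
  refine ⟨⟨φ, hB ⁻¹' e.baseSet, e.open_baseSet.preimage hB.continuous, hs, ?_, ?_⟩, he⟩
  · ext ⟨p, y⟩
    simp [φ, e.target_eq]
  · intro p hp
    have hp' : hE p ∈ e.source := by
      rw [hs, mem_preimage, mem_preimage, hf] at hp
      rw [e.source_eq]; exact hp
    change hB.symm (e (hE p)).1 = f p
    rw [hB.symm_apply_eq, hf]
    exact e.proj_toFun _ hp'

/-- The projection of the affine model to its base. -/
def affineProjection (m : ℕ) (p : affineModel m) : affineBase m := ⟨p.1.2, p.2.1, p.2.2.1⟩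

/-- An equivalence over `B` that is bicontinuous over the open set `S` is a trivialization
over `S`. -/
def trivializationOfEquiv {E B Y : Type} [TopologicalSpace E] [TopologicalSpace B]
    [TopologicalSpace Y] {f : E → B} (hf : Continuous f) (φ : E ≃ B × Y)
    (hφ : ∀ p, (φ p).1 = f p) {S : Set B} (hS : IsOpen S) (h₁ : ContinuousOn φ (f ⁻¹' S))
    (h₂ : ContinuousOn φ.symm (S ×ˢ univ)) : Bundle.Trivialization Y f where
  toFun := φ
  invFun := φ.symm
  source := f ⁻¹' S
  target := S ×ˢ univ
  map_source' p hp := ⟨by rw [hφ]; exact hp, mem_univ _⟩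
  map_target' q hq := by
    rw [mem_preimage, ← hφ, φ.apply_symm_apply]
    exact hq.1
  left_inv' p _ := φ.symm_apply_apply p
  right_inv' q _ := φ.apply_symm_apply q
  continuousOn_toFun := h₁
  continuousOn_invFun := h₂
  open_source := hS.preimage hf
  open_target := hS.prod isOpen_univ
  baseSet := S
  open_baseSet := hS
  source_eq := rfl
  target_eq := rfl
  proj_toFun p _ := hφ p

/-- The root is defined everywhere but continuous only near c. The straightening is then a global
bijection, and only its continuity has to be localized. -/
theorem exists_root_continuousAt {m : ℕ} (hm : m ≠ 0) {c : ℂ} (hc : c ≠ 0) :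
    ∃ (r : ℂ → ℂ) (V : Set ℂ), IsOpen V ∧ c ∈ V ∧ ContinuousOn r V ∧ ∀ z, r z ^ m = z := by
  obtain ⟨d, hd⟩ := IsAlgClosed.exists_pow_nat_eq c (Nat.pos_of_ne_zero hm)
  refine ⟨fun z => d * (z / c) ^ ((m : ℂ)⁻¹), {z | z / c ∈ Complex.slitPlane},
    Complex.isOpen_slitPlane.preimage (by fun_prop), ?_, ?_, fun z => ?_⟩
  · rw [mem_ofPred_eq, div_self hc]
    exact Complex.one_mem_slitPlane
  · exact continuousOn_const.mul (ContinuousOn.cpow_const (by fun_prop) fun _ h => h)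
  · rw [mul_pow, Complex.cpow_nat_inv_pow _ hm, hd, mul_div_cancel₀ _ hc]

/-- A choice of `m`-th roots of `1 + y ^ m` straightens the fibres of the affine model. -/
noncomputable def affineModelEquiv {m : ℕ} (u : affineBase m → ℂ) (um : ∀ y, u y ^ m = 1 + y.1 ^ m)
    (u0 : ∀ y, u y ≠ 0) : affineModel m ≃ affineBase m × {t : ℂ | t ^ m + 1 ≠ 0} where
  toFun p := (affineProjection m p, ⟨p.1.1 * u (affineProjection m p), by
    have := p.2.2.2
    rwa [mem_ofPred_eq, mul_pow, um]⟩)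
  invFun q := ⟨(q.2.1 / u q.1, q.1), q.1.2.1, q.1.2.2, by
    have := q.2.2
    rw [← um, div_pow, div_mul_cancel₀ _ (pow_ne_zero m (u0 q.1))]
    exact this⟩
  left_inv p := Subtype.ext (Prod.ext (mul_div_cancel_right₀ _ (u0 _)) rfl)
  right_inv q := Prod.ext rfl (Subtype.ext (div_mul_cancel₀ _ (u0 _)))

theorem isLocallyTrivialFibration_affineProjection {m : ℕ} (hm : m ≠ 0) :
    IsLocallyTrivialFibration (affineProjection m) := by
  refine ⟨{t : ℂ | t ^ m + 1 ≠ 0}, inferInstance, fun b => ?_⟩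
  obtain ⟨r, V, hV, hbV, hr, hrm⟩ := exists_root_continuousAt hm b.2.2
  have hs : Continuous fun y : affineBase m => 1 + y.1 ^ m := by fun_prop
  have u0 : ∀ y : affineBase m, r (1 + y.1 ^ m) ≠ 0 := by
    intro y h
    apply y.2.2
    rw [← hrm (1 + y.1 ^ m), h, zero_pow hm]
  have uS : ContinuousOn (fun y : affineBase m => r (1 + y.1 ^ m))
      ((fun y : affineBase m => 1 + y.1 ^ m) ⁻¹' V) :=
    hr.comp hs.continuousOn (mapsTo_preimage _ _)
  have hproj : Continuous (affineProjection m) := by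
    unfold affineProjection
    fun_prop
  refine ⟨trivializationOfEquiv hproj
    (affineModelEquiv (fun y => r (1 + y.1 ^ m)) (fun y => hrm _) u0) (fun _ => rfl)
    (hV.preimage hs) ?_ ?_, hbV⟩
  · exact hproj.continuousOn.prodMk (Topology.IsInducing.subtypeVal.continuousOn_iff.mpr
      ((continuous_fst.comp continuous_subtype_val).continuousOn.mul
        (uS.comp hproj.continuousOn (mapsTo_preimage _ _))))
  · exact Topology.IsInducing.subtypeVal.continuousOn_iff.mpr
      (((continuous_subtype_val.comp continuous_snd).continuousOn.div
        (uS.comp continuousOn_fst fun q hq => hq.1) fun q _ => u0 q.1).prodMk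
      (continuous_subtype_val.comp continuous_fst).continuousOn)

end AffineModel

end PlaneCurve

namespace PlaneCurve

/-! ### Passage from the projective plane and the pencil to affine coordinates. -/

section Chart
open Set

theorem continuous_mk' (K V : Type*) [DivisionRing K] [AddCommGroup V] [Module K V]
    [TopologicalSpace V] : Continuous (Projectivization.mk' K (V := V)) :=
  continuous_coinduced_rng

theorem isQuotientMap_mk' (K V : Type*) [DivisionRing K] [AddCommGroup V] [Module K V]
    [TopologicalSpace V] : Topology.IsQuotientMap (Projectivization.mk' K (V := V)) :=
  ⟨⟨rfl⟩, Quotient.mk_surjective⟩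

/-- The ratio of two linear forms, as a function on the projectivization. -/
noncomputable def ratio {V : Type*} [AddCommGroup V] [Module ℂ V] (α β : V →ₗ[ℂ] ℂ) (q : ℙ ℂ V) :
    ℂ := α q.rep / β q.rep

section Ratio

variable {V : Type*} [AddCommGroup V] [Module ℂ V]

theorem ratio_mk (α β : V →ₗ[ℂ] ℂ) (v : V) (hv : v ≠ 0) :
    ratio α β (Projectivization.mk ℂ v hv) = α v / β v := by
  obtain ⟨a, ha⟩ := Projectivization.exists_smul_eq_mk_rep ℂ v hv
  rw [ratio, ← ha, Units.smul_def, map_smul, map_smul, smul_eq_mul, smul_eq_mul,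
    mul_div_mul_left _ _ a.ne_zero]

theorem apply_rep_mk_ne_zero_iff (β : V →ₗ[ℂ] ℂ) (v : V) (hv : v ≠ 0) :
    β (Projectivization.mk ℂ v hv).rep ≠ 0 ↔ β v ≠ 0 := by
  obtain ⟨a, ha⟩ := Projectivization.exists_smul_eq_mk_rep ℂ v hv
  rw [← ha, Units.smul_def, map_smul, smul_eq_mul, mul_ne_zero_iff, and_iff_right a.ne_zero]

theorem continuousOn_ratio [TopologicalSpace V] (α β : V →ₗ[ℂ] ℂ) (hα : Continuous α)
    (hβ : Continuous β) : ContinuousOn (ratio α β) {q | β q.rep ≠ 0} := by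
  have hpre : Projectivization.mk' ℂ ⁻¹' {q : ℙ ℂ V | β q.rep ≠ 0} =
      {v : {v : V // v ≠ 0} | β v ≠ 0} := by
    ext v
    exact apply_rep_mk_ne_zero_iff β v.1 v.2
  have hopen : IsOpen {q : ℙ ℂ V | β q.rep ≠ 0} := by
    rw [← (isQuotientMap_mk' ℂ V).isOpen_preimage, hpre]
    exact isOpen_ne_fun (hβ.comp continuous_subtype_val) continuous_const
  rw [(isQuotientMap_mk' ℂ V).continuousOn_isOpen_iff hopen, hpre]
  have : ratio α β ∘ Projectivization.mk' ℂ = fun v : {v : V // v ≠ 0} => α v / β v := by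
    funext v
    exact ratio_mk α β v.1 v.2
  rw [this]
  exact ContinuousOn.div (hα.comp continuous_subtype_val).continuousOn
    (hβ.comp continuous_subtype_val).continuousOn fun v hv => hv

end Ratio

theorem eval_curve (m : ℕ) (v : Fin 3 → ℂ) : MvPolynomial.eval v (curve m) =
    v 1 * v 2 * (v 0 ^ m * v 1 ^ m + v 1 ^ m * v 2 ^ m + v 0 ^ m * v 2 ^ m) *
      (v 1 ^ m + v 2 ^ m) := by
  simp [curve]

theorem mk_mem_points_iff (m : ℕ) (v : Fin 3 → ℂ) (hv : v ≠ 0) :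
    Projectivization.mk ℂ v hv ∈ points (curve m) ↔ MvPolynomial.eval v (curve m) = 0 := by
  obtain ⟨a, ha⟩ := Projectivization.exists_smul_eq_mk_rep ℂ v hv
  have h1 : (Projectivization.mk ℂ v hv).rep = (a : ℂ) • v := ha.symm
  have h2 : MvPolynomial.eval ((a : ℂ) • v) (curve m) =
      (a : ℂ) ^ (1 + 1 + (m + m) + m) * MvPolynomial.eval v (curve m) := by
    simp only [eval_curve, Pi.smul_apply, smul_eq_mul]
    ring
  rw [points, mem_ofPred_eq, h1, h2, mul_eq_zero, or_iff_right (pow_ne_zero _ a.ne_zero)]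

/-- Using x/y instead of x/z makes the constant term of the fibre equation equal to 1, so an m-th
root of 1 + s^m alone straightens the fibres. -/
theorem eval_curve_eq_mul (m : ℕ) {v : Fin 3 → ℂ} (h1 : v 1 ≠ 0) (h2 : v 2 ≠ 0) :
    MvPolynomial.eval v (curve m) = v 1 ^ (m + 1) * v 2 ^ (2 * m + 1) *
      (((v 0 / v 1) ^ m * (1 + (v 1 / v 2) ^ m) + 1) * (1 + (v 1 / v 2) ^ m)) := by
  rw [eval_curve, div_pow, div_pow]
  field_simp
  ring

/-- The `i`-th homogeneous coordinate. -/
abbrev coord (i : Fin 3) : (Fin 3 → ℂ) →ₗ[ℂ] ℂ := LinearMap.proj i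

theorem rep_ne_zero_of_mem_complement {m : ℕ} {q : P2} (hq : q ∈ complement (curve m)) :
    q.rep 1 ≠ 0 ∧ q.rep 2 ≠ 0 := by
  constructor <;>
  · intro h
    apply hq
    rw [points, mem_ofPred_eq, eval_curve, h]
    ring

theorem ratio_mem_affineModel {m : ℕ} {q : P2} (hq : q ∈ complement (curve m)) :
    (ratio (coord 0) (coord 1) q, ratio (coord 1) (coord 2) q) ∈ affineModel m := by
  obtain ⟨h1, h2⟩ := rep_ne_zero_of_mem_complement hq
  have h3 : MvPolynomial.eval q.rep (curve m) ≠ 0 := hq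
  rw [eval_curve_eq_mul m h1 h2] at h3
  have h4 := (mul_ne_zero_iff.mp (right_ne_zero_of_mul h3))
  exact ⟨div_ne_zero h1 h2, h4.2, h4.1⟩

theorem vec_ne_zero (a b : ℂ) : (![a, b, 1] : Fin 3 → ℂ) ≠ 0 := fun h => by
  simpa using congrFun h 2

theorem mk_mem_complement {m : ℕ} {p : ℂ × ℂ} (hp : p ∈ affineModel m) :
    Projectivization.mk ℂ ![p.1 * p.2, p.2, 1] (vec_ne_zero _ _) ∈ complement (curve m) := by
  rw [complement, mem_compl_iff, mk_mem_points_iff, eval_curve_eq_mul m hp.1 one_ne_zero]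
  have h := hp.1
  have h2 := hp.2.2
  have h1 := hp.2.1
  simp [mul_div_cancel_right₀ _ h, h, h1, h2]

/-- The complement of the curve is homeomorphic to its affine model. -/
noncomputable def complementHomeomorph (m : ℕ) : complement (curve m) ≃ₜ affineModel m where
  toFun q := ⟨_, ratio_mem_affineModel q.2⟩
  invFun p := ⟨_, mk_mem_complement p.2⟩
  left_inv q := by
    apply Subtype.ext
    obtain ⟨h1, h2⟩ := rep_ne_zero_of_mem_complement q.2
    conv_rhs => rw [← Projectivization.mk_rep q.1]
    rw [Projectivization.mk_eq_mk_iff']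
    refine ⟨(q.1.rep 2)⁻¹, ?_⟩
    funext i
    fin_cases i <;> simp [ratio] <;> field_simp
  right_inv p := by
    apply Subtype.ext
    simp [ratio_mk, mul_div_cancel_right₀ _ p.2.1]
  continuous_toFun := by
    have h := fun i j : Fin 3 => continuousOn_ratio (coord i) (coord j) (continuous_apply i)
      (continuous_apply j)
    exact Continuous.subtype_mk (((h 0 1).comp_continuous continuous_subtype_val
      fun q => (rep_ne_zero_of_mem_complement q.2).1).prodMk
      ((h 1 2).comp_continuous continuous_subtype_val
      fun q => (rep_ne_zero_of_mem_complement q.2).2)) _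
  continuous_invFun := by
    refine Continuous.subtype_mk ((continuous_mk' ℂ (Fin 3 → ℂ)).comp
      (f := fun p : affineModel m => ⟨![p.1.1 * p.1.2, p.1.2, 1], vec_ne_zero _ _⟩) ?_) _
    fun_prop

theorem p₁_mem_points (m : ℕ) : p₁ ∈ points (curve m) := by
  rw [p₁, mk_mem_points_iff, eval_curve]
  simp

/-- A linear form vanishing on `(1, 0, 0)`, as a linear form on the quotient. -/
noncomputable def quotientCoord (i : Fin 3) (hi : i ≠ 0) :
    ((Fin 3 → ℂ) ⧸ p₁.submodule) →ₗ[ℂ] ℂ :=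
  p₁.submodule.liftQ (coord i) (by
    rw [p₁, Projectivization.submodule_mk, Submodule.span_singleton_le_iff_mem]
    fin_cases i
    · exact absurd rfl hi
    · simp
    · simp)

theorem quotientCoord_mkQ {i : Fin 3} (hi : i ≠ 0) (v : Fin 3 → ℂ) :
    quotientCoord i hi (p₁.submodule.mkQ v) = v i := by
  simp [quotientCoord]

theorem continuous_quotientCoord {i : Fin 3} (hi : i ≠ 0) : Continuous (quotientCoord i hi) := by
  rw [p₁.submodule.isOpenQuotientMap_mkQ.isQuotientMap.continuous_iff]
  have : quotientCoord i hi ∘ p₁.submodule.mkQ = fun v => v i :=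
    funext fun v => quotientCoord_mkQ hi v
  rw [this]
  exact continuous_apply i

/-- The coordinate `y / z` on the pencil of lines through `(1 : 0 : 0)`. -/
noncomputable def pencilCoord : Pencil p₁ → ℂ :=
  ratio (quotientCoord 1 (by decide)) (quotientCoord 2 (by decide))

theorem pencilCoord_mk {v : Fin 3 → ℂ} (hv : p₁.submodule.mkQ v ≠ 0) :
    pencilCoord (Projectivization.mk ℂ (p₁.submodule.mkQ v) hv) = v 1 / v 2 := by
  rw [pencilCoord, ratio_mk, quotientCoord_mkQ, quotientCoord_mkQ]

theorem continuousOn_pencilCoord :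
    ContinuousOn pencilCoord {l | quotientCoord 2 (by decide) l.rep ≠ 0} :=
  continuousOn_ratio _ _ (continuous_quotientCoord _) (continuous_quotientCoord _)

theorem mkQ_vec_ne_zero (a b : ℂ) : p₁.submodule.mkQ ![a, b, 1] ≠ 0 := by
  intro h
  have := congrArg (quotientCoord 2 (by decide)) h
  rw [quotientCoord_mkQ, map_zero] at this
  simp at this

/-- The line joining `(1 : 0 : 0)` and `(0 : y : 1)`. -/
noncomputable def pencilLine (y : ℂ) : Pencil p₁ :=
  Projectivization.mk ℂ (p₁.submodule.mkQ ![0, y, 1]) (mkQ_vec_ne_zero 0 y)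

theorem continuous_pencilLine : Continuous pencilLine := by
  refine (continuous_mk' ℂ ((Fin 3 → ℂ) ⧸ p₁.submodule)).comp
    (f := fun y : ℂ => ⟨p₁.submodule.mkQ ![0, y, 1], mkQ_vec_ne_zero 0 y⟩) ?_
  refine Continuous.subtype_mk (p₁.submodule.isOpenQuotientMap_mkQ.continuous.comp ?_) _
  fun_prop

theorem pencilCoord_complementProjection {m : ℕ} (q : complement (curve m)) :
    pencilCoord (complementProjection (curve m) p₁ (p₁_mem_points m) q) =
      (complementHomeomorph m q).1.2 :=
  pencilCoord_mk _

theorem complementProjection_eq_pencilLine {m : ℕ} (q : complement (curve m)) :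
    complementProjection (curve m) p₁ (p₁_mem_points m) q =
      pencilLine (complementHomeomorph m q).1.2 := by
  obtain ⟨h1, h2⟩ := rep_ne_zero_of_mem_complement q.2
  rw [complementProjection, centralProjection, pencilLine, Projectivization.mk_eq_mk_iff']
  refine ⟨q.1.rep 2, ?_⟩
  rw [← map_smul, ← sub_eq_zero, ← map_sub, Submodule.mkQ_apply, Submodule.Quotient.mk_eq_zero]
  -- Rescaling (0, y/z, 1) by z gives (0, y, z), which differs from (x, y, z) by −x (1, 0, 0).
  refine Submodule.mem_span_singleton.mpr ⟨-q.1.rep 0, ?_⟩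
  funext i
  fin_cases i <;> simp [complementHomeomorph, ratio, mul_div_cancel₀ _ h2]

theorem pencilLine_mem_range {m : ℕ} (hm : m ≠ 0) {y : ℂ} (hy : y ∈ affineBase m) :
    pencilLine y ∈ range (complementProjection (curve m) p₁ (p₁_mem_points m)) := by
  refine ⟨(complementHomeomorph m).symm ⟨(0, y), hy.1, hy.2, by simp [hm]⟩, ?_⟩
  rw [complementProjection_eq_pencilLine, Homeomorph.apply_symm_apply]

/-- The image of the complement under the central projection from `(1 : 0 : 0)`, in the affine
coordinate `y / z`. -/
noncomputable def rangeHomeomorph {m : ℕ} (hm : m ≠ 0) :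
    range (complementProjection (curve m) p₁ (p₁_mem_points m)) ≃ₜ affineBase m where
  toFun l := ⟨pencilCoord l, by
    obtain ⟨_, q, rfl⟩ := l
    rw [pencilCoord_complementProjection]
    exact ⟨(complementHomeomorph m q).2.1, (complementHomeomorph m q).2.2.1⟩⟩
  invFun y := ⟨pencilLine y, pencilLine_mem_range hm y.2⟩
  left_inv l := by
    obtain ⟨_, q, rfl⟩ := l
    apply Subtype.ext
    simp only [pencilCoord_complementProjection, ← complementProjection_eq_pencilLine]
  right_inv y := by
    apply Subtype.ext
    exact (pencilCoord_mk _).trans (by simp)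
  continuous_toFun := by
    refine Continuous.subtype_mk (continuousOn_pencilCoord.comp_continuous
      continuous_subtype_val ?_) _
    suffices h : ∀ y, quotientCoord 2 (by decide) (pencilLine y).rep ≠ 0 by
      rintro ⟨_, q, rfl⟩
      simp only [complementProjection_eq_pencilLine]
      exact h _
    intro y
    rw [pencilLine, apply_rep_mk_ne_zero_iff, quotientCoord_mkQ]
    simp
  continuous_invFun :=
    Continuous.subtype_mk (continuous_pencilLine.comp continuous_subtype_val) _

theorem isModularPoint_p₁ {m : ℕ} (hm : m ≠ 0) : IsModularPoint (curve m) p₁ :=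
  ⟨p₁_mem_points m, IsLocallyTrivialFibration.of_homeomorph (f' := affineProjection m)
    (complementHomeomorph m) (rangeHomeomorph hm)
    (fun q => Subtype.ext (pencilCoord_complementProjection q))
    (isLocallyTrivialFibration_affineProjection hm)⟩

end Chart

end PlaneCurve

theorem mainTheorem9 (m : ℕ) (hm : 2 ≤ m) :
    PlaneCurve.IsModularPoint (PlaneCurve.curve m) PlaneCurve.p₁ ∧
      PlaneCurve.IsSupersolvable (PlaneCurve.curve m) ∧
      PlaneCurve.IsKPiOne (PlaneCurve.complement (PlaneCurve.curve m)) := by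
  have hm0 : m ≠ 0 := by omega
  have h := PlaneCurve.isModularPoint_p₁ hm0
  exact ⟨h, ⟨PlaneCurve.isReducedCurve_curve hm0, _, h⟩,
    (PlaneCurve.isKPiOne_affineModel hm0).of_homeomorph (PlaneCurve.complementHomeomorph m)⟩
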